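/- For every integer $r \ge 8$, the expansion of $$\frac{1}{1-(t_1+\cdots+t_r)+r!\,t_1t_2\cdots t_r}$$ as a power series in $t_1,\ldots,t_r$ around the origin (that is, the multiplicative inverse of the denominator in the ring of formal power series $\mathbb{R}[[t_1,\ldots,t_r]]$) has only nonnegative coefficients. -/

import Mathlib

/-- The polynomial `1 - (t₁ + ⋯ + t_r) + r! t₁ ⋯ t_r`, as a real formal power series
in the variables `t₁, …, t_r` (indexed by `Fin r`). -/
noncomputable def grzDenom (r : ℕ) : MvPowerSeries (Fin r) ℝ :=
  1 - ∑ i : Fin r, MvPowerSeries.X i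
    + MvPowerSeries.C (r.factorial : ℝ) * ∏ i : Fin r, MvPowerSeries.X i

/-! Let D be the denominator. It suffices to find φ with nonnegative coefficients such that φ * D =
1 - ρ, where ρ ≥ 0 has no constant term: then 1/D = φ(1 + ρ + ρ² + ⋯). Take φ with coefficients M(m)
w(m), M multinomial. With n the degree of m and σ = `diagRatio`, dividing by M(m) turns ρ ≥ 0 into
w(m) ≤ ∑ⱼ (mⱼ/n) w(m - eⱼ) - σ(m) w(m - 1). Up to degree r + 2, w solves this with equality. From
degree r + 3 on, w depends on n only and decays geometrically with ratio q = 1 - 1/(2(r-1)), slowly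
enough to stay comparable over r - 1 degrees, yet fast enough to absorb the σ term, which is O(r⁻⁴)
there (`diagRatio_le`). The inequality is `comparisonWeight_le`. -/

open Finset in
theorem prod_map_sub_single {ι : Type*} [Fintype ι] [DecidableEq ι] (f : ℕ → ℝ) (m : ι → ℕ)
    (j : ι) :
    (∏ i, f ((m - Pi.single j 1 : _ → ℕ) i)) * f (m j) = (∏ i, f (m i)) * f (m j - 1) := by
  rw [← mul_prod_erase univ _ (mem_univ j), ← mul_prod_erase univ (fun i => f (m i)) (mem_univ j)]
  have h : ∏ i ∈ univ.erase j, f ((m - Pi.single j 1 : _ → ℕ) i) = ∏ i ∈ univ.erase j, f (m i) :=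
    prod_congr rfl fun i hi => by simp [ne_of_mem_erase hi]
  rw [h]
  simp
  ring

open Finset in
theorem sum_sub_single_add_one {ι : Type*} [Fintype ι] [DecidableEq ι] {m : ι → ℕ} {j : ι}
    (hj : 0 < m j) : ∑ i, (m - Pi.single j 1 : _ → ℕ) i + 1 = ∑ i, m i := by
  rw [← add_sum_erase univ _ (mem_univ j), ← add_sum_erase univ m (mem_univ j)]
  have h : ∑ i ∈ univ.erase j, (m - Pi.single j 1 : _ → ℕ) i = ∑ i ∈ univ.erase j, m i :=
    sum_congr rfl fun i hi => by simp [ne_of_mem_erase hi]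
  rw [h]
  simp
  omega

theorem sum_sub_one_add_card {r : ℕ} {m : Fin r → ℕ} (hm : ∀ i, 0 < m i) :
    ∑ i, (m - 1) i + r = ∑ i, m i := by
  have h : ∑ i, m i = ∑ i, ((m - 1) i + 1) :=
    Finset.sum_congr rfl fun i _ => by have := hm i; simp; omega
  rw [h, Finset.sum_add_distrib]
  simp

/-! ### Multinomial coefficients and the diagonal ratio -/

/-- The multinomial coefficient `(∑ mᵢ)! / ∏ mᵢ!`, as a real number. -/
noncomputable def multinomialReal {r : ℕ} (m : Fin r → ℕ) : ℝ :=
  ((∑ i, m i).factorial : ℝ) / ∏ i, ((m i).factorial : ℝ)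

theorem multinomialReal_pos {r : ℕ} (m : Fin r → ℕ) : 0 < multinomialReal m := by
  unfold multinomialReal
  positivity

/-- The ratio of `r!` times the multinomial coefficient at `m - 1` to the one at `m`. -/
noncomputable def diagRatio {r : ℕ} (m : Fin r → ℕ) : ℝ :=
  r.factorial * (∏ i, (m i : ℝ)) * (∑ i, m i - r).factorial / (∑ i, m i).factorial

theorem diagRatio_nonneg {r : ℕ} (m : Fin r → ℕ) : 0 ≤ diagRatio m := by
  unfold diagRatio
  positivity

theorem diagRatio_eq_zero {r : ℕ} {m : Fin r → ℕ} {j : Fin r} (hj : m j = 0) :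
    diagRatio m = 0 := by
  have : ∏ i, (m i : ℝ) = 0 := Finset.prod_eq_zero (Finset.mem_univ j) (by simp [hj])
  simp [diagRatio, this]

theorem multinomialReal_sub_single {r : ℕ} {m : Fin r → ℕ} {j : Fin r} (hj : 0 < m j) :
    multinomialReal (m - Pi.single j 1) = m j / (∑ i, m i : ℕ) * multinomialReal m := by
  have h1 := sum_sub_single_add_one hj
  have h2 := prod_map_sub_single (fun n => (n.factorial : ℝ)) m j
  unfold multinomialReal
  rw [← h1, Nat.factorial_succ]
  obtain ⟨k, hk⟩ : ∃ k, m j = k + 1 := ⟨m j - 1, by omega⟩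
  simp only [hk, Nat.factorial_succ, Nat.add_sub_cancel] at h2 ⊢
  have h3 : (∏ i, ((m i).factorial : ℝ)) =
      (∏ i, (((m - Pi.single j 1 : _ → ℕ) i).factorial : ℝ)) * ((k + 1 : ℕ) : ℝ) := by
    have : (k.factorial : ℝ) ≠ 0 := by positivity
    apply mul_right_cancel₀ this
    rw [← h2]
    push_cast
    ring
  rw [h3]
  generalize ∑ i, (m - Pi.single j 1 : _ → ℕ) i = s
  have : (∏ i, (((m - Pi.single j 1 : _ → ℕ) i).factorial : ℝ)) ≠ 0 := by positivity
  push_cast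
  field_simp

theorem multinomialReal_sub_one {r : ℕ} {m : Fin r → ℕ} (hm : ∀ i, 0 < m i) :
    r.factorial * multinomialReal (m - 1) = diagRatio m * multinomialReal m := by
  have h1 := sum_sub_one_add_card hm
  have h2 : ∑ i, m i - r = ∑ i, (m - 1) i := by omega
  have h3 : (∏ i, ((m i).factorial : ℝ)) =
      (∏ i, (m i : ℝ)) * ∏ i, (((m - 1) i).factorial : ℝ) := by
    rw [← Finset.prod_mul_distrib]
    refine Finset.prod_congr rfl fun i _ => ?_
    rw [← Nat.mul_factorial_pred (hm i).ne']
    simp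
  unfold multinomialReal diagRatio
  rw [h2, h3]
  have : (∏ i, (m i : ℝ)) ≠ 0 := Finset.prod_ne_zero_iff.2 fun i _ => by
    have := hm i
    positivity
  have : (∏ i, (((m - 1) i).factorial : ℝ)) ≠ 0 := by positivity
  field_simp

/-! ### Upper bounds for the diagonal ratio -/

theorem prod_le_two_pow {r : ℕ} {m : Fin r → ℕ} (hm : ∀ i, 0 < m i) :
    ∏ i, (m i : ℝ) ≤ 2 ^ (∑ i, m i - r) := by
  have h1 := sum_sub_one_add_card hm
  rw [show ∑ i, m i - r = ∑ i, (m - 1) i by omega, ← Finset.prod_pow_eq_pow_sum]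
  refine Finset.prod_le_prod (fun i _ => by positivity) fun i _ => ?_
  have h : m i ≤ 2 ^ (m i - 1) := by
    have := Nat.lt_two_pow_self (n := m i - 1)
    omega
  exact_mod_cast h

theorem diagRatio_le_of_sum_eq {r k : ℕ} {m : Fin r → ℕ} (hm : ∀ i, 0 < m i)
    (hs : ∑ i, m i = r + k) :
    diagRatio m ≤ 2 ^ k * k.factorial * r.factorial / (r + k).factorial := by
  have h := prod_le_two_pow hm
  unfold diagRatio
  rw [hs, Nat.add_sub_cancel_left] at h ⊢
  rw [show (2 ^ k * k.factorial * r.factorial : ℝ) = r.factorial * 2 ^ k * k.factorial by ring]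
  gcongr

theorem diagRatio_sub_single {r : ℕ} {m : Fin r → ℕ} (hm : ∀ i, 0 < m i) {j : Fin r}
    (hs : r < ∑ i, m i) :
    diagRatio m * (m j - 1) * (∑ i, m i : ℕ) =
      diagRatio (m - Pi.single j 1) * m j * ((∑ i, m i : ℕ) - r) := by
  have h1 := sum_sub_single_add_one (hm j)
  have h2 := prod_map_sub_single (fun n => (n : ℝ)) m j
  unfold diagRatio
  obtain ⟨k, hk⟩ : ∃ k, ∑ i, m i = r + k + 1 := ⟨∑ i, m i - r - 1, by omega⟩
  have h3 : ∑ i, (m - Pi.single j 1 : _ → ℕ) i = r + k := by omega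
  rw [hk, h3, show r + k + 1 - r = k + 1 by omega, show r + k - r = k by omega,
    Nat.factorial_succ, Nat.factorial_succ]
  have h4 : ((m j - 1 : ℕ) : ℝ) = m j - 1 := by
    rw [Nat.cast_sub (hm j)]
    simp
  rw [h4] at h2
  push_cast
  field_simp
  linear_combination -h2 * (k + 1 : ℝ)

/-- Lower a maximal coordinate: n ≤ r mⱼ is equivalent to mⱼ(n - r) ≤ (mⱼ - 1)n, which compares the
two factors in `diagRatio_sub_single`. -/
theorem exists_diagRatio_le_sub_single {r : ℕ} {m : Fin r → ℕ} (hm : ∀ i, 0 < m i)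
    (hs : r < ∑ i, m i) :
    ∃ j, 1 < m j ∧ diagRatio m ≤ diagRatio (m - Pi.single j 1) := by
  have hne : (Finset.univ : Finset (Fin r)).Nonempty := by
    by_contra h
    rw [Finset.not_nonempty_iff_eq_empty] at h
    simp [h] at hs
  obtain ⟨j, -, hj⟩ := Finset.exists_max_image Finset.univ m hne
  have hle : ∑ i, m i ≤ r * m j := by
    simpa using Finset.sum_le_card_nsmul Finset.univ m (m j) hj
  have hj1 : 1 < m j := by
    by_contra! h
    have := hm j
    have : m j = 1 := by omega
    rw [this] at hle
    omega
  refine ⟨j, hj1, ?_⟩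
  have h := diagRatio_sub_single hm (j := j) hs
  have hle' : ((∑ i, m i : ℕ) : ℝ) ≤ r * m j := by exact_mod_cast hle
  have hs' : (r : ℝ) < (∑ i, m i : ℕ) := by exact_mod_cast hs
  have hj1' : (1 : ℝ) < m j := by exact_mod_cast hj1
  generalize ((∑ i, m i : ℕ) : ℝ) = s at *
  have hpos : 0 < (m j - 1) * s := mul_pos (by linarith) (by linarith [Nat.cast_nonneg (α := ℝ) r])
  refine le_of_mul_le_mul_right ?_ hpos
  rw [← mul_assoc, h, mul_assoc]
  exact mul_le_mul_of_nonneg_left (by linarith) (diagRatio_nonneg _)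

/-- Descend to degree r + 4 without decreasing the ratio; there the bound has 384 = 2⁴ · 4!. -/
theorem diagRatio_le {r : ℕ} (k : ℕ) {m : Fin r → ℕ} (hs : ∑ i, m i = r + 4 + k) :
    diagRatio m ≤ 384 / ((r + 1) * (r + 2) * (r + 3) * (r + 4)) := by
  by_cases hm : ∀ i, 0 < m i
  swap
  · push Not at hm
    obtain ⟨j, hj⟩ := hm
    rw [diagRatio_eq_zero (Nat.le_zero.1 hj)]
    positivity
  induction k generalizing m with
  | zero =>
    refine (diagRatio_le_of_sum_eq hm (k := 4) hs).trans (le_of_eq ?_)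
    simp only [Nat.factorial_succ, Nat.factorial_zero]
    push_cast
    field_simp
    ring
  | succ k ih =>
    obtain ⟨j, hj, hle⟩ := exists_diagRatio_le_sub_single hm (by omega)
    have h1 := sum_sub_single_add_one (hm j)
    refine hle.trans (ih (by omega) fun i => ?_)
    by_cases hij : i = j
    · subst hij
      simpa using hj
    · simpa [hij] using hm i

/-! ### Comparison weights -/

/-- The factor by which the coefficients of the comparison series differ from multinomial
coefficients: exact up to degree `r + 2`, geometric from there on. -/
noncomputable def comparisonWeight {r : ℕ} (m : Fin r → ℕ) : ℝ :=
  if ∑ i, m i ≤ r + 2 then 1 - ((∑ i, m i : ℕ) - r + 1) * diagRatio m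
  else 4 / 5 * (1 - 1 / (2 * (r - 1))) ^ (∑ i, m i - r - 3)

theorem diagRatio_low {r k : ℕ} {m : Fin r → ℕ} {c : ℝ} (hm : ∀ i, 0 < m i)
    (hs : ∑ i, m i = r + k)
    (hc : (k + 1) * (2 ^ k * k.factorial * r.factorial) ≤ c * (r + k).factorial) :
    ((∑ i, m i : ℕ) - r + 1) * diagRatio m ≤ c := by
  have h := diagRatio_le_of_sum_eq hm hs
  rw [hs]
  push_cast
  calc (r + k - r + 1 : ℝ) * diagRatio m
      ≤ (k + 1) * (2 ^ k * k.factorial * r.factorial / (r + k).factorial) := by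
        rw [add_sub_cancel_left]
        gcongr
    _ ≤ c := by
        rw [← mul_div_assoc, div_le_iff₀ (by positivity)]
        exact hc

theorem diagRatio_low_le_one {r : ℕ} (hr : 8 ≤ r) {m : Fin r → ℕ} (hs : ∑ i, m i ≤ r + 2) :
    ((∑ i, m i : ℕ) - r + 1) * diagRatio m ≤ 1 := by
  by_cases hm : ∀ i, 0 < m i
  swap
  · push Not at hm
    obtain ⟨j, hj⟩ := hm
    rw [diagRatio_eq_zero (Nat.le_zero.1 hj)]
    simp
  have hr' : (8 : ℝ) ≤ r := by exact_mod_cast hr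
  have h1 := sum_sub_one_add_card hm
  have hf : (0 : ℝ) < r.factorial := by positivity
  obtain h | h | h : ∑ i, m i = r + 0 ∨ ∑ i, m i = r + 1 ∨ ∑ i, m i = r + 2 := by omega
  · exact diagRatio_low hm h (by simp)
  · refine diagRatio_low hm h ?_
    simp only [Nat.factorial_succ, Nat.factorial_zero]
    push_cast
    nlinarith
  · refine diagRatio_low hm h ?_
    simp only [Nat.factorial_succ, Nat.factorial_zero]
    push_cast
    have : (24 : ℝ) ≤ (r + 1 + 1) * (r + 1) := by nlinarith
    linarith [mul_le_mul_of_nonneg_right this hf.le]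

theorem diagRatio_low_le_fifth {r : ℕ} (hr : 8 ≤ r) {m : Fin r → ℕ} (hs : ∑ i, m i = r + 3) :
    ((∑ i, m i : ℕ) - r + 1) * diagRatio m ≤ 1 / 5 := by
  by_cases hm : ∀ i, 0 < m i
  swap
  · push Not at hm
    obtain ⟨j, hj⟩ := hm
    rw [diagRatio_eq_zero (Nat.le_zero.1 hj)]
    norm_num
  have hr' : (8 : ℝ) ≤ r := by exact_mod_cast hr
  refine diagRatio_low hm hs ?_
  simp only [Nat.factorial_succ, Nat.factorial_zero]
  push_cast
  -- The requirement is 5 · 4 · 2³ · 3! = 960 ≤ (r+1)(r+2)(r+3).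
  have h2 : (990 : ℝ) ≤ (r + 2 + 1) * (r + 1 + 1) * (r + 1) := by
    calc (990 : ℝ) = (8 + 2 + 1) * (8 + 1 + 1) * (8 + 1) := by norm_num
      _ ≤ _ := by gcongr
  have hf : (0 : ℝ) < r.factorial := by positivity
  linarith [mul_le_mul_of_nonneg_right h2 hf.le]

theorem comparisonRatio_bounds {r : ℕ} (hr : 8 ≤ r) :
    (0 : ℝ) < 1 - 1 / (2 * (r - 1)) ∧ (1 : ℝ) - 1 / (2 * (r - 1)) ≤ 1 := by
  have hr' : (8 : ℝ) ≤ r := by exact_mod_cast hr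
  have h : (0 : ℝ) < 2 * (r - 1) := by linarith
  constructor
  · rw [sub_pos, div_lt_one h]
    linarith
  · have : 0 < 1 / (2 * ((r : ℝ) - 1)) := by positivity
    linarith

theorem comparisonWeight_nonneg {r : ℕ} (hr : 8 ≤ r) (m : Fin r → ℕ) :
    0 ≤ comparisonWeight m := by
  have hq := (comparisonRatio_bounds hr).1
  unfold comparisonWeight
  split_ifs with h
  · linarith [diagRatio_low_le_one hr h]
  · positivity

theorem comparisonWeight_le_one {r : ℕ} (hr : 8 ≤ r) (m : Fin r → ℕ) :
    comparisonWeight m ≤ 1 := by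
  have hq := comparisonRatio_bounds hr
  unfold comparisonWeight
  split_ifs with h
  · by_cases hm : ∀ i, 0 < m i
    · have h1 := sum_sub_one_add_card hm
      have h2 : (r : ℝ) ≤ (∑ i, m i : ℕ) := by exact_mod_cast (by omega : r ≤ ∑ i, m i)
      have := mul_nonneg (show (0 : ℝ) ≤ (∑ i, m i : ℕ) - r + 1 by linarith) (diagRatio_nonneg m)
      linarith
    · push Not at hm
      obtain ⟨j, hj⟩ := hm
      rw [diagRatio_eq_zero (Nat.le_zero.1 hj)]
      simp
  · have := pow_le_one₀ (n := ∑ i, m i - r - 3) hq.1.le hq.2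
    linarith

theorem comparisonWeight_of_eq_zero {r : ℕ} {m : Fin r → ℕ} (hs : ∑ i, m i ≤ r + 2) {j : Fin r}
    (hj : m j = 0) : comparisonWeight m = 1 := by
  simp [comparisonWeight, hs, diagRatio_eq_zero hj]

/-- By `diagRatio_sub_single`, the correction at m - eⱼ is a multiple of the ratio at m. Summed over
j, the corrections total (n - r) `diagRatio m`. -/
theorem mul_comparisonWeight_sub_single {r : ℕ} {m : Fin r → ℕ} (hs : ∑ i, m i ≤ r + 3)
    (j : Fin r) :
    (m j / (∑ i, m i : ℕ) : ℝ) * comparisonWeight (m - Pi.single j 1) =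
      m j / (∑ i, m i : ℕ) - (m j - 1) * diagRatio m := by
  rcases Nat.eq_zero_or_pos (m j) with hj | hj
  · simp [hj, diagRatio_eq_zero hj]
  have h1 := sum_sub_single_add_one hj
  by_cases hm : ∀ i, 0 < m i
  swap
  · push Not at hm
    obtain ⟨l, hl⟩ := hm
    have hl := Nat.le_zero.1 hl
    rw [comparisonWeight_of_eq_zero (j := l) (by omega) (by simp [hl]), diagRatio_eq_zero hl]
    simp
  have h2 := sum_sub_one_add_card hm
  rcases (show r ≤ ∑ i, m i by omega).eq_or_lt with h3 | h3
  · have hj1 : m j = 1 := by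
      have : ∑ i, (m - 1) i = 0 := by omega
      have := Finset.sum_eq_zero_iff.1 this j (Finset.mem_univ j)
      simp at this
      omega
    rw [comparisonWeight_of_eq_zero (j := j) (by omega) (by simp [hj1]), hj1]
    simp
  have h4 := diagRatio_sub_single hm (j := j) h3
  have h5 : ((∑ i, (m - Pi.single j 1 : _ → ℕ) i : ℕ) : ℝ) = (∑ i, m i : ℕ) - 1 := by
    rw [← h1]
    simp
  have h6 : ((∑ i, m i : ℕ) : ℝ) ≠ 0 := by
    have : 0 < ∑ i, m i := by omega
    positivity
  rw [comparisonWeight, if_pos (by omega), h5]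
  generalize ((∑ i, m i : ℕ) : ℝ) = s at *
  field_simp
  linear_combination h4

theorem comparisonWeight_step_of_le {r : ℕ} (hr : 8 ≤ r) {m : Fin r → ℕ}
    (h0 : 0 < ∑ i, m i) (hs : ∑ i, m i ≤ r + 3) :
    ∑ j, (m j / (∑ i, m i : ℕ) : ℝ) * comparisonWeight (m - Pi.single j 1) -
      diagRatio m * comparisonWeight (m - 1) = 1 - ((∑ i, m i : ℕ) - r + 1) * diagRatio m := by
  -- Here m - 1 has degree at most 3 < r, so some coordinate vanishes and its weight is 1.
  have h1 : diagRatio m * comparisonWeight (m - 1) = diagRatio m := by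
    by_cases hm : ∀ i, 0 < m i
    · have h2 := sum_sub_one_add_card hm
      obtain ⟨j, hj⟩ : ∃ j, (m - 1) j = 0 := by
        by_contra! h
        have h3 : ∑ _i : Fin r, 1 ≤ ∑ i, (m - 1) i :=
          Finset.sum_le_sum fun i _ => Nat.one_le_iff_ne_zero.2 (h i)
        simp only [Finset.sum_const, Finset.card_univ, Fintype.card_fin, smul_eq_mul] at h3
        omega
      rw [comparisonWeight_of_eq_zero (by omega) hj, mul_one]
    · push Not at hm
      obtain ⟨j, hj⟩ := hm
      rw [diagRatio_eq_zero (Nat.le_zero.1 hj), zero_mul]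
  rw [h1, Finset.sum_congr rfl fun j _ => mul_comparisonWeight_sub_single hs j,
    Finset.sum_sub_distrib, ← Finset.sum_div, ← Finset.sum_mul, Finset.sum_sub_distrib]
  have h6 : ((∑ i, m i : ℕ) : ℝ) ≠ 0 := by positivity
  rw [← Nat.cast_sum, div_self h6]
  simp
  ring

/-- Bernoulli's inequality gives q^(r-1) ≥ 1/2 and q^(r-2) ≥ r/(2(r-1)), where q = 1 - 1/(2(r-1)).
-/
theorem comparison_numeric {r : ℕ} (hr : 8 ≤ r) :
    (384 / ((r + 1) * (r + 2) * (r + 3) * (r + 4)) : ℝ) ≤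
        4 / 5 * (1 - 1 / (2 * (r - 1))) ^ (r - 2) * (1 / (2 * (r - 1))) ∧
      (384 / ((r + 1) * (r + 2) * (r + 3) * (r + 4)) : ℝ) ≤
        (1 - 1 / (2 * (r - 1))) ^ (r - 1) * (1 / (2 * (r - 1))) := by
  -- In t = r - 8 the cleared differences have nonnegative coefficients.
  obtain ⟨t, rfl⟩ := Nat.exists_eq_add_of_le hr
  have b (n : ℕ) : 1 + n * (-(1 / (2 * ((8 + t : ℕ) - 1)))) ≤
      (1 - 1 / (2 * ((8 + t : ℕ) - 1)) : ℝ) ^ n := by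
    have := (comparisonRatio_bounds hr).1
    simpa [sub_eq_add_neg] using one_add_mul_le_pow (a := -(1 / (2 * ((8 + t : ℕ) - 1)) : ℝ))
      (by linarith) n
  have b1 := b (8 + t - 2)
  have b2 := b (8 + t - 1)
  rw [show 8 + t - 2 = t + 6 by omega] at *
  rw [show 8 + t - 1 = t + 7 by omega] at *
  push_cast at b1 b2 ⊢
  have e : (8 + t - 1 : ℝ) = t + 7 := by ring
  rw [e] at b1 b2 ⊢
  have ht : (0 : ℝ) ≤ t := Nat.cast_nonneg t
  have hθ : (0 : ℝ) ≤ 1 / (2 * (t + 7)) := by positivity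
  constructor
  · calc _ ≤ (4 / 5 : ℝ) * (1 + (t + 6) * -(1 / (2 * (t + 7)))) * (1 / (2 * (t + 7))) := by
          rw [show (4 / 5 : ℝ) * (1 + (t + 6) * -(1 / (2 * (t + 7)))) * (1 / (2 * (t + 7))) =
            (t + 8) / (5 * (t + 7) ^ 2) by field_simp; ring]
          rw [div_le_div_iff₀ (by positivity) (by positivity)]
          rw [← sub_nonneg]
          ring_nf
          positivity
      _ ≤ _ := by gcongr
  · calc _ ≤ (1 + (t + 7) * -(1 / (2 * (t + 7)))) * (1 / (2 * (t + 7)) : ℝ) := by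
          rw [show (1 + (t + 7) * -(1 / (2 * (t + 7)))) * (1 / (2 * (t + 7)) : ℝ) =
            1 / (4 * (t + 7)) by field_simp; ring]
          rw [div_le_div_iff₀ (by positivity) (by positivity)]
          rw [← sub_nonneg]
          ring_nf
          positivity
      _ ≤ _ := by gcongr

theorem comparisonWeight_le {r : ℕ} (hr : 8 ≤ r) {m : Fin r → ℕ} (h0 : 0 < ∑ i, m i) :
    comparisonWeight m ≤
      ∑ j, (m j / (∑ i, m i : ℕ) : ℝ) * comparisonWeight (m - Pi.single j 1) -
        diagRatio m * comparisonWeight (m - 1) := by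
  rcases le_or_gt (∑ i, m i) (r + 3) with hs | hs
  · rw [comparisonWeight_step_of_le hr h0 hs, comparisonWeight]
    split_ifs with h
    · exact le_rfl
    · have h3 : ∑ i, m i = r + 3 := by omega
      rw [show ∑ i, m i - r - 3 = 0 by omega, pow_zero]
      linarith [diagRatio_low_le_fifth hr h3]
  obtain ⟨k, hk⟩ : ∃ k, ∑ i, m i = r + 4 + k := ⟨∑ i, m i - (r + 4), by omega⟩
  have hq := comparisonRatio_bounds hr
  obtain ⟨n1, n2⟩ := comparison_numeric hr
  have hσ := diagRatio_le k hk
  set q : ℝ := 1 - 1 / (2 * (r - 1)) with hqdef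
  have hθ : (1 / (2 * (r - 1)) : ℝ) = 1 - q := by rw [hqdef]; ring
  rw [hθ] at n1 n2
  have h1 : ∑ j, (m j / (∑ i, m i : ℕ) : ℝ) * comparisonWeight (m - Pi.single j 1) =
      4 / 5 * q ^ k := by
    have h2 (j : Fin r) : (m j / (∑ i, m i : ℕ) : ℝ) * comparisonWeight (m - Pi.single j 1) =
        (m j / (∑ i, m i : ℕ) : ℝ) * (4 / 5 * q ^ k) := by
      rcases Nat.eq_zero_or_pos (m j) with hj | hj
      · simp [hj]
      · have := sum_sub_single_add_one hj
        rw [comparisonWeight, if_neg (by omega),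
          show ∑ i, (m - Pi.single j 1 : _ → ℕ) i - r - 3 = k by omega]
    rw [Finset.sum_congr rfl fun j _ => h2 j, ← Finset.sum_mul, ← Finset.sum_div,
      ← Nat.cast_sum, div_self (by positivity), one_mul]
  have hw : comparisonWeight m = 4 / 5 * q ^ (k + 1) := by
    rw [comparisonWeight, if_neg (by omega), show ∑ i, m i - r - 3 = k + 1 by omega]
  rw [h1, hw, pow_succ]
  suffices h : diagRatio m * comparisonWeight (m - 1) ≤ 4 / 5 * q ^ k * (1 - q) by linarith
  by_cases hm : ∀ i, 0 < m i
  swap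
  · push Not at hm
    obtain ⟨j, hj⟩ := hm
    rw [diagRatio_eq_zero (Nat.le_zero.1 hj), zero_mul]
    have : 0 ≤ 1 - q := by linarith
    have := hq.1
    positivity
  have hs1 := sum_sub_one_add_card hm
  have hq1 : 0 ≤ 1 - q := by linarith
  -- The degree of m - 1 is k + 4, so k ≤ r - 2 is exactly the range where its weight is not yet
  -- geometric; there it is bounded by 1.
  rcases le_or_gt k (r - 2) with hkr | hkr
  · calc diagRatio m * comparisonWeight (m - 1)
        ≤ diagRatio m * 1 :=
          mul_le_mul_of_nonneg_left (comparisonWeight_le_one hr _) (diagRatio_nonneg m)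
      _ ≤ 4 / 5 * q ^ (r - 2) * (1 - q) := by linarith
      _ ≤ 4 / 5 * q ^ k * (1 - q) := by
          have := pow_le_pow_of_le_one hq.1.le hq.2 hkr
          gcongr
  · have hw1 : comparisonWeight (m - 1) = 4 / 5 * q ^ (k - (r - 1)) := by
      rw [comparisonWeight, if_neg (by omega),
        show ∑ i, (m - 1) i - r - 3 = k - (r - 1) by omega]
    have hp : q ^ k = q ^ (r - 1) * q ^ (k - (r - 1)) := by
      rw [← pow_add]
      congr 1
      omega
    rw [hw1, hp]
    have := hq.1
    calc diagRatio m * (4 / 5 * q ^ (k - (r - 1)))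
        ≤ (q ^ (r - 1) * (1 - q)) * (4 / 5 * q ^ (k - (r - 1))) := by
          gcongr
          linarith
      _ = _ := by ring

theorem comparison_subsolution {r : ℕ} (hr : 8 ≤ r) {m : Fin r → ℕ} (h0 : 0 < ∑ i, m i) :
    multinomialReal m * comparisonWeight m ≤
      ∑ j, (if 0 < m j then multinomialReal (m - Pi.single j 1) *
          comparisonWeight (m - Pi.single j 1) else 0) -
        r.factorial * (if ∀ i, 0 < m i then multinomialReal (m - 1) * comparisonWeight (m - 1)
          else 0) := by
  have h := mul_le_mul_of_nonneg_left (comparisonWeight_le hr h0) (multinomialReal_pos m).le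
  refine h.trans (le_of_eq ?_)
  rw [mul_sub, Finset.mul_sum]
  congr 1
  · refine Finset.sum_congr rfl fun j _ => ?_
    split_ifs with hj
    · rw [multinomialReal_sub_single hj]
      ring
    · simp [Nat.eq_zero_of_not_pos hj]
  · split_ifs with hm
    · rw [← mul_assoc, ← mul_assoc, multinomialReal_sub_one hm]
      ring
    · push Not at hm
      obtain ⟨j, hj⟩ := hm
      simp [diagRatio_eq_zero (Nat.le_zero.1 hj)]

/-! ### Passage to power series -/

theorem coeff_mul_grzDenom {r : ℕ} (φ : MvPowerSeries (Fin r) ℝ) (m : Fin r →₀ ℕ) :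
    MvPowerSeries.coeff m (φ * grzDenom r) = MvPowerSeries.coeff m φ -
      ∑ j, (if 0 < m j then MvPowerSeries.coeff (m - Finsupp.single j 1) φ else 0) +
      r.factorial * (if ∀ i, 0 < m i then
        MvPowerSeries.coeff (m - Finsupp.equivFunOnFinite.symm 1) φ else 0) := by
  have hX : ∏ i : Fin r, (MvPowerSeries.X i : MvPowerSeries (Fin r) ℝ) =
      MvPowerSeries.monomial (Finsupp.equivFunOnFinite.symm 1) 1 := by
    simp only [MvPowerSeries.X_def]
    rw [MvPowerSeries.prod_monomial]
    congr 1
    · congr 1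
      ext i
      simp [Finsupp.finsetSum_apply, Finsupp.single_apply]
    · simp
  have hle : Finsupp.equivFunOnFinite.symm (1 : Fin r → ℕ) ≤ m ↔ ∀ i, 0 < m i := by
    rw [Finsupp.le_def]
    simp [Nat.one_le_iff_ne_zero, Nat.pos_iff_ne_zero]
  have hle1 (j : Fin r) : Finsupp.single j 1 ≤ m ↔ 0 < m j := by
    rw [Finsupp.single_le_iff]
    exact Nat.one_le_iff_ne_zero.trans Nat.pos_iff_ne_zero.symm
  rw [grzDenom, hX, mul_add, mul_sub, mul_one, Finset.mul_sum, map_add, map_sub, map_sum,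
    mul_left_comm, MvPowerSeries.coeff_C_mul, MvPowerSeries.coeff_mul_monomial]
  simp only [MvPowerSeries.X_def, MvPowerSeries.coeff_mul_monomial, mul_one, hle, hle1]

theorem constantCoeff_grzDenom {r : ℕ} (hr : 0 < r) :
    MvPowerSeries.constantCoeff (grzDenom r) = 1 := by
  have : NeZero r := ⟨hr.ne'⟩
  have h : (MvPowerSeries.constantCoeff (∏ i : Fin r, (MvPowerSeries.X i)) : ℝ) = 0 := by
    rw [map_prod]
    exact Finset.prod_eq_zero (Finset.mem_univ 0) (by simp)
  simp [grzDenom, h]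

/-- If `φ * ψ = 1 - ρ` where `φ` and `ρ` have nonnegative coefficients and `ρ` has no constant
term, then the inverse of `ψ` has nonnegative coefficients. -/
theorem coeff_inv_nonneg_of_mul_eq_one_sub {σ : Type*} {φ ψ ρ : MvPowerSeries σ ℝ}
    (hψ : MvPowerSeries.constantCoeff ψ ≠ 0) (h : φ * ψ = 1 - ρ)
    (hφ : ∀ m, 0 ≤ MvPowerSeries.coeff m φ) (hρ : ∀ m, 0 ≤ MvPowerSeries.coeff m ρ)
    (hρ0 : MvPowerSeries.coeff 0 ρ = 0) (m : σ →₀ ℕ) : 0 ≤ MvPowerSeries.coeff m ψ⁻¹ := by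
  classical
  -- This recursion replaces the geometric series: as ρ has no constant term, only strictly smaller
  -- exponents of ψ⁻¹ contribute.
  have e : ψ⁻¹ = φ + ψ⁻¹ * ρ := by
    have h1 : φ = (1 - ρ) * ψ⁻¹ := by
      rw [← h, mul_assoc, MvPowerSeries.mul_inv_cancel _ hψ, mul_one]
    rw [h1]
    ring
  induction m using WellFoundedLT.induction with
  | _ m ih =>
    rw [e, map_add, MvPowerSeries.coeff_mul]
    refine add_nonneg (hφ m) (Finset.sum_nonneg fun p hp => ?_)
    rw [Finset.HasAntidiagonal.mem_antidiagonal] at hp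
    rcases eq_or_ne p.2 0 with h2 | h2
    · simp [h2, hρ0]
    · refine mul_nonneg (ih p.1 ?_) (hρ _)
      rw [← hp]
      exact lt_add_of_pos_right _ (pos_iff_ne_zero.2 h2)

theorem theorem1 (r : ℕ) (hr : 8 ≤ r) :
    grzDenom r * (grzDenom r)⁻¹ = 1 ∧
      ∀ m : Fin r →₀ ℕ, 0 ≤ MvPowerSeries.coeff m (grzDenom r)⁻¹ := by
  have hc : MvPowerSeries.constantCoeff (grzDenom r) ≠ 0 := by
    rw [constantCoeff_grzDenom (by omega)]
    exact one_ne_zero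
  refine ⟨MvPowerSeries.mul_inv_cancel _ hc, ?_⟩
  let φ : MvPowerSeries (Fin r) ℝ := fun m => multinomialReal ⇑m * comparisonWeight ⇑m
  have hφ (m : Fin r →₀ ℕ) :
      MvPowerSeries.coeff m φ = multinomialReal ⇑m * comparisonWeight ⇑m := rfl
  have hρ0 : MvPowerSeries.coeff 0 (1 - φ * grzDenom r) = 0 := by
    have : NeZero r := ⟨by omega⟩
    have h : ¬ ∀ i : Fin r, 0 < (0 : Fin r →₀ ℕ) i := fun h => absurd (h 0) (by simp)
    have hs : ∑ i, (0 : Fin r →₀ ℕ) i ≤ r + 2 := by simp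
    rw [map_sub, coeff_mul_grzDenom, if_neg h, hφ,
      comparisonWeight_of_eq_zero hs (j := 0) (by simp)]
    simp [multinomialReal]
  refine coeff_inv_nonneg_of_mul_eq_one_sub hc (φ := φ) (ρ := 1 - φ * grzDenom r) (by ring)
    (fun m => ?_) (fun m => ?_) hρ0
  · rw [hφ]
    exact mul_nonneg (multinomialReal_pos _).le (comparisonWeight_nonneg hr _)
  · rcases eq_or_ne m 0 with rfl | hm
    · exact hρ0.ge
    have h0 : 0 < ∑ i, m i := by
      rw [Nat.pos_iff_ne_zero]
      intro h
      exact hm (Finsupp.ext fun i => Finset.sum_eq_zero_iff.1 h i (Finset.mem_univ i))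
    have h := comparison_subsolution hr h0
    rw [map_sub, coeff_mul_grzDenom, MvPowerSeries.coeff_one, if_neg hm]
    simp only [hφ, Finsupp.coe_tsub, Finsupp.single_eq_pi_single,
      Finsupp.coe_equivFunOnFinite_symm]
    linarith
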